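/- Let $\alpha\in(0,1)$ and, for each integer $d\ge 1$, consider the step-reinforced random walk $S=(S_n)_{n\ge 0}$ on the group $(\mathbb{Z}_2^d,+)$ with reinforcement parameter $\alpha$ and step distribution $\mu$ given by $$\mu(0)=\tfrac12,\qquad \mu(e_k)=\tfrac1{2d},\quad k=1,\dots,d,$$ where $e_k$ is the $k$-th standard basis vector. That is, $S_0=0$ and $S_n=X_1+\dots+X_n$, where $X_1$ has law $\mu$ and, for $n\ge 2$, given $X_1,\dots,X_{n-1}$, with probability $\alpha$ one sets $X_n=X_u$ with $u$ uniform on $\{1,\dots,n-1\}$, and with probability $1-\alpha$ the step $X_n$ is a fresh sample from $\mu$. With $U$ the uniform distribution on $\mathbb{Z}_2^d$ and $\|\nu_1-\nu_2\|_{\mathrm{TV}}=\frac12\sum_g|\nu_1(g)-\nu_2(g)|$, let $$t^{(\alpha)}_{\mathrm{mix}}(\varepsilon)=\inf\{n\ge 1:\ \|\mathbb{P}(S_m=\cdot)-U\|_{\mathrm{TV}}\le\varepsilon\ \text{ for all } m\ge n\},$$ and let $t^{(0)}_{\mathrm{mix}}(\varepsilon)$ be the same quantity for the walk without reinforcement,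 whose steps are i.i.d. with law $\mu$. Then for every $\varepsilon\in(0,1)$, $$\lim_{d\to\infty}\frac{t^{(\alpha)}_{\mathrm{mix}}(\varepsilon)}{d\log d}=\frac{1}{(1-\alpha)\;{}_2F_1\!\left(1,\alpha^{-1};\alpha^{-1}+1;\tfrac12\right)},$$ where ${}_2F_1(a,b;c;z)=\sum_{m\ge 0}\frac{(a)_m(b)_m}{(c)_m}\frac{z^m}{m!}$, with $(a)_0=1$ and $(a)_m=a(a+1)\cdots(a+m-1)$. Consequently, for every $\varepsilon\in(0,1)$, the walk has cutoff, $$\lim_{d\to\infty}\frac{t^{(\alpha)}_{\mathrm{mix}}(\varepsilon)}{t^{(\alpha)}_{\mathrm{mix}}(1-\varepsilon)}=1,$$ and it mixes more slowly than the non-reinforced walk: $t^{(\alpha)}_{\mathrm{mix}}(\varepsilon)>t^{(0)}_{\mathrm{mix}}(\varepsilon)$ for all sufficiently large $d$. -/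

import Mathlib

open Filter Topology

noncomputable section

namespace SRRW

/-- The Bernoulli distribution with success parameter `p ∈ [0,1]`; success is `true`. -/
def coin (p : unitInterval) : PMF Bool :=
  PMF.ofFintype (fun b => cond b (ENNReal.ofReal (p : ℝ)) (ENNReal.ofReal (1 - (p : ℝ)))) (by
    rw [Fintype.sum_bool, cond_true, cond_false,
      ← ENNReal.ofReal_add p.2.1 (sub_nonneg.2 p.2.2), add_sub_cancel, ENNReal.ofReal_one])

section Walk

variable {G : Type*}

/-- The conditional law of the step `X_{n+1}` given the past steps `x = (X_1, …, X_n)`.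
The first step has law `μ`. Later, a coin with success parameter `α` is tossed: on success the
step is `X_u` for a uniformly random past index `u`, on failure it is a fresh sample of `μ`. -/
def nextStep (μ : PMF G) (α : unitInterval) : (n : ℕ) → (Fin n → G) → PMF G
  | 0, _ => μ
  | n + 1, x => (coin α).bind fun ξ =>
      if ξ = true then (PMF.uniformOfFintype (Fin (n + 1))).map x else μ

/-- The joint law of the first `n` steps `(X_1, …, X_n)` of the step-reinforced random walk
with step distribution `μ` and reinforcement parameter `α`, generated one step at a time. -/
def stepsLaw (μ : PMF G) (α : unitInterval) : (n : ℕ) → PMF (Fin n → G)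
  | 0 => PMF.pure Fin.elim0
  | n + 1 => (stepsLaw μ α n).bind fun x =>
      (nextStep μ α n x).map fun g => (Fin.snoc x g : Fin (n + 1) → G)

/-- The law of the position `S_n = X_1 + ⋯ + X_n` of the step-reinforced random walk on an
abelian group, written additively, started from the identity. -/
def walkLaw [AddCommGroup G] (μ : PMF G) (α : unitInterval) (n : ℕ) : PMF G :=
  (stepsLaw μ α n).map fun x => ∑ i, x i

/-- The total variation distance of two probability measures on a finite set. -/
def tvDist [Fintype G] (p q : PMF G) : ℝ :=
  (1 / 2) * ∑ g, |(p g).toReal - (q g).toReal|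

/-- The `ε`-mixing time: the least `n ≥ 1` such that for all `m ≥ n` the law of `S_m` is within
total variation distance `ε` of the uniform distribution. -/
def mixingTime [AddCommGroup G] [Fintype G] (μ : PMF G) (α : unitInterval) (ε : ℝ) : ℕ :=
  sInf {n : ℕ | 1 ≤ n ∧
    ∀ m, n ≤ m → tvDist (walkLaw μ α m) (PMF.uniformOfFintype G) ≤ ε}

end Walk

/-- The parameter `1/2` of a fair coin. -/
def half : unitInterval := ⟨1 / 2, by norm_num, by norm_num⟩

/-- The step distribution of the lazy simple random walk on the hypercube `ℤ₂^d`, `d ≥ 1`: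
with probability `1/2` the step is `0`, otherwise it is the basis vector `e_k` for a uniformly
random coordinate `k`. For `d = 0` the group is trivial and the only distribution is taken. -/
def lazyStep : (d : ℕ) → PMF (Fin d → ZMod 2)
  | 0 => PMF.pure 0
  | d + 1 => (coin half).bind fun h =>
      if h = true then (PMF.uniformOfFintype (Fin (d + 1))).map fun k => Pi.single k 1
      else PMF.pure 0

/-- The identity has mass `1/2`. -/
theorem lazyStep_zero (d : ℕ) (hd : 1 ≤ d) : lazyStep d 0 = 1 / 2 := by
  obtain ⟨d, rfl⟩ := Nat.exists_eq_add_of_le' hd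
  have h : ∀ k : Fin (d + 1), (0 : Fin (d + 1) → ZMod 2) ≠ Pi.single k 1 := fun k hk => by
    simpa using congrFun hk k
  simp only [lazyStep, PMF.bind_apply, tsum_bool, coin, PMF.ofFintype_apply, cond_true,
    cond_false, half, if_true, Bool.false_eq_true, if_false, PMF.pure_apply, PMF.map_apply]
  simp only [h, if_false, tsum_zero, mul_zero, add_zero, mul_one]
  rw [show (1 - 1 / 2 : ℝ) = 2⁻¹ by norm_num, ENNReal.ofReal_inv_of_pos (by norm_num)]
  simp

/-- Each basis vector has mass `1/(2d)`. -/
theorem lazyStep_single (d : ℕ) (k : Fin d) :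
    lazyStep d (Pi.single k 1) = 1 / (2 * (d : ENNReal)) := by
  obtain ⟨d, rfl⟩ := Nat.exists_eq_succ_of_ne_zero (Fin.pos k).ne'
  have h : (Pi.single k 1 : Fin (d + 1) → ZMod 2) ≠ 0 := fun hk => by
    simpa using congrFun hk k
  have h' : ∀ j : Fin (d + 1),
      (Pi.single k 1 : Fin (d + 1) → ZMod 2) = Pi.single j 1 ↔ j = k := fun j => by
    constructor
    · intro e
      by_contra hj
      have := congrFun e k
      simp [Pi.single_eq_of_ne (Ne.symm hj)] at this
    · rintro rfl; rfl
  simp only [lazyStep, PMF.bind_apply, tsum_bool, coin, PMF.ofFintype_apply, cond_true,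
    cond_false, half, if_true, Bool.false_eq_true, if_false, PMF.pure_apply, PMF.map_apply]
  simp only [h, h', if_false, mul_zero, zero_add, tsum_ite_eq, PMF.uniformOfFintype_apply,
    Fintype.card_fin]
  rw [one_div, one_div, ENNReal.ofReal_inv_of_pos (by norm_num),
    ENNReal.mul_inv (Or.inl (by norm_num)) (Or.inl (by norm_num))]
  simp

end SRRW

end

/-!
The steps of the walk fall into clusters of steps that copy one another. Given the clusters, the
walk adds up one independent sample of the step law per cluster, multiplied by the size of the
cluster, and in `ℤ₂^d` only the parity of the size matters (`mean_stepsLaw`,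
`labelMean_character`). Hence `S_n` is distributed as the walk without reinforcement after as many
steps as there are odd clusters, and the theorem follows from a law of large numbers for the number
of odd clusters and the mixing behaviour of the lazy walk on the hypercube.

*Odd clusters.* A new step increases a cluster of size `k` by one with probability `α k / n`, so
sums over clusters of an eigenfunction of `h ↦ (k ↦ k (h (k + 1) - h k))` with eigenvalue `-m` are
easy to follow: after centring at `n (1 - α) / (1 + α m)`, the drift of such a sum points towards
`0`, and its variance grows at most linearly (`mean_clusterSum_sub_sq_le`). The functions
`(-1) ^ (k - 1) * (m - 1).choose (k - 1)`, with the constant `1` for `m = 0`, are such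
eigenfunctions, and the indicator of odd `k` is half the sum over all `m` of these functions with
weights `2 ^ (-m)` (`hasSum_eigenfun`). The truncation error of this
series is at most `θ k` for all `k` at once (`eventually_abs_oddInd_sub_le`), so the number of odd
clusters divided by `n` converges in probability to
`oddRate α = (1 - α) / 2 * ∑ m, 2 ^ (-m) / (1 + α m)` (`eventually_mean_oddCount_le`). This sum is
the hypergeometric value of the theorem (`two_mul_oddRate`).

*Hypercube.* The character of `A ⊆ {1, …, d}` has mean `1 - |A| / d` under one step. By Plancherel
and the Cauchy-Schwarz inequality, after `N` steps the distance to uniformity is small when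
`d * exp (-2 N / d)` is small (`tvDist_le`); by Chebyshev's inequality for `∑ i, (-1) ^ g i`, it is
close to `1` when `d * (1 - 1 / d) ^ (2 N)` is large (`le_tvDist`). The transition is at
`N ∼ d log d / 2`, which gives `t_mix ∼ d log d / (2 * oddRate α)` for every `α ∈ [0, 1)`
(`tendsto_mixingTime`). The case `α = 0` is included, so the comparison with the walk without
reinforcement reduces to `oddRate α < 1 = oddRate 0`.
-/

noncomputable section

namespace SRRW

/-! ### Expectations over finite types -/

/-- The expectation of a real function under a probability mass function on a finite type. -/
def mean {A : Type*} [Fintype A] (p : PMF A) (F : A → ℝ) : ℝ := ∑ a, (p a).toReal * F a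

section Mean

variable {A B : Type*} [Fintype A] [Fintype B]

theorem sum_toReal (p : PMF A) : ∑ a, (p a).toReal = 1 := by
  rw [← ENNReal.toReal_sum fun a _ => p.apply_ne_top a, ← tsum_fintype (L := .unconditional _),
    p.tsum_coe, ENNReal.toReal_one]

theorem mean_const (p : PMF A) (r : ℝ) : mean p (fun _ => r) = r := by
  rw [mean, ← Finset.sum_mul, sum_toReal, one_mul]

theorem mean_pure (a : A) (F : A → ℝ) : mean (PMF.pure a) F = F a := by
  classical
  simp [mean, PMF.pure_apply, apply_ite ENNReal.toReal]

theorem mean_bind (p : PMF A) (f : A → PMF B) (F : B → ℝ) :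
    mean (p.bind f) F = mean p fun a => mean (f a) F := by
  simp only [mean, PMF.bind_apply, tsum_fintype, Finset.mul_sum]
  rw [Finset.sum_comm]
  refine Finset.sum_congr rfl fun b _ => ?_
  rw [ENNReal.toReal_sum fun a _ => ENNReal.mul_ne_top (p.apply_ne_top a) ((f a).apply_ne_top b),
    Finset.sum_mul]
  simp [ENNReal.toReal_mul, mul_assoc]

theorem mean_map (p : PMF A) (f : A → B) (F : B → ℝ) :
    mean (p.map f) F = mean p fun a => F (f a) := by
  simp only [← PMF.bind_pure_comp, mean_bind, Function.comp_apply, mean_pure]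

theorem mean_uniform [Nonempty A] (F : A → ℝ) :
    mean (PMF.uniformOfFintype A) F = (Fintype.card A : ℝ)⁻¹ * ∑ a, F a := by
  simp [mean, Finset.mul_sum]

theorem mean_coin (p : unitInterval) (F : Bool → ℝ) :
    mean (coin p) F = p * F true + (1 - p) * F false := by
  simp [mean, coin, ENNReal.toReal_ofReal p.2.1, ENNReal.toReal_ofReal (sub_nonneg.2 p.2.2)]

theorem mean_add (p : PMF A) (F F' : A → ℝ) :
    mean p (fun a => F a + F' a) = mean p F + mean p F' := by
  simp [mean, mul_add, Finset.sum_add_distrib]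

theorem mean_const_mul (p : PMF A) (r : ℝ) (F : A → ℝ) :
    mean p (fun a => r * F a) = r * mean p F := by
  simp [mean, Finset.mul_sum, mul_left_comm]

theorem mean_sum (p : PMF A) {I : Type*} (s : Finset I) (F : I → A → ℝ) :
    mean p (fun a => ∑ i ∈ s, F i a) = ∑ i ∈ s, mean p (F i) := by
  simp only [mean, Finset.mul_sum]
  exact Finset.sum_comm

theorem mean_mono (p : PMF A) {F F' : A → ℝ} (h : ∀ a, F a ≤ F' a) : mean p F ≤ mean p F' :=
  Finset.sum_le_sum fun a _ => mul_le_mul_of_nonneg_left (h a) ENNReal.toReal_nonneg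

theorem abs_mean_le (p : PMF A) (F : A → ℝ) : |mean p F| ≤ mean p fun a => |F a| := by
  refine (Finset.abs_sum_le_sum_abs _ _).trans_eq (Finset.sum_congr rfl fun a _ => ?_)
  rw [abs_mul, abs_of_nonneg ENNReal.toReal_nonneg]

theorem toReal_apply_eq_mean [DecidableEq A] (p : PMF A) (a : A) :
    (p a).toReal = mean p fun b => if b = a then 1 else 0 := by
  simp [mean]

end Mean

/-! ### The clusters of steps that copy one another -/

section Clusters

variable {G : Type*}

theorem mean_nextStep_succ [Fintype G] (μ : PMF G) (α : unitInterval) (n : ℕ)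
    (x : Fin (n + 1) → G) (F : G → ℝ) :
    mean (nextStep μ α (n + 1) x) F =
      α * (((n + 1 : ℕ) : ℝ)⁻¹ * ∑ u, F (x u)) + (1 - α) * mean μ F := by
  simp [nextStep, mean_bind, mean_coin, mean_map, mean_uniform]

theorem mean_stepsLaw_succ [Fintype G] (μ : PMF G) (α : unitInterval) (n : ℕ)
    (F : (Fin (n + 1) → G) → ℝ) :
    mean (stepsLaw μ α (n + 1)) F = mean (stepsLaw μ α n) fun x =>
      mean (nextStep μ α n x) fun g => F (Fin.snoc x g : Fin (n + 1) → G) := by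
  simp only [stepsLaw, mean_bind, mean_map]

/-- The joint law of the cluster labels of the first `n` steps. A step that copies an earlier one
receives the label of that step; a fresh step, the one with index `i`, founds a cluster with
label `i`. -/
def labelsLaw (α : unitInterval) : (n : ℕ) → PMF (Fin n → Fin n)
  | 0 => PMF.pure Fin.elim0
  | n + 1 => (labelsLaw α n).bind fun l =>
      (nextStep (PMF.pure (Fin.last n)) α n fun i => (l i).castSucc).map fun j =>
        (Fin.snoc (fun i => (l i).castSucc) j : Fin (n + 1) → Fin (n + 1))

theorem mean_labelsLaw_succ (α : unitInterval) (n : ℕ)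
    (F : (Fin (n + 1) → Fin (n + 1)) → ℝ) :
    mean (labelsLaw α (n + 1)) F = mean (labelsLaw α n) fun l =>
      mean (nextStep (PMF.pure (Fin.last n)) α n fun i => (l i).castSucc) fun j =>
        F (Fin.snoc (fun i => (l i).castSucc) j : Fin (n + 1) → Fin (n + 1)) := by
  simp only [labelsLaw, mean_bind, mean_map]

/-- The expectation of a function of `n` independent samples of `μ`. -/
def iidMean [Fintype G] (μ : PMF G) (n : ℕ) (F : (Fin n → G) → ℝ) : ℝ :=
  ∑ y : Fin n → G, (∏ j, (μ (y j)).toReal) * F y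

theorem iidMean_succ [Fintype G] (μ : PMF G) (n : ℕ) (F : (Fin (n + 1) → G) → ℝ) :
    iidMean μ (n + 1) F =
      iidMean μ n fun y => mean μ fun g => F (Fin.snoc y g : Fin (n + 1) → G) := by
  simp only [iidMean, mean, Finset.mul_sum]
  rw [← (Fin.snocEquiv fun _ : Fin (n + 1) => G).sum_comp, Fintype.sum_prod_type, Finset.sum_comm]
  simp [Fin.snocEquiv, Fin.prod_univ_castSucc, mul_assoc]

theorem iidMean_nonneg [Fintype G] (μ : PMF G) (n : ℕ) (F : (Fin n → G) → ℝ) (hF : ∀ y, 0 ≤ F y) :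
    0 ≤ iidMean μ n F :=
  Finset.sum_nonneg fun y _ =>
    mul_nonneg (Finset.prod_nonneg fun _ _ => ENNReal.toReal_nonneg) (hF y)

/-- Given the clusters, the steps are obtained by attaching an independent sample of `μ` to each
cluster. -/
theorem mean_stepsLaw [Fintype G] (μ : PMF G) (α : unitInterval) (n : ℕ)
    (F : (Fin n → G) → ℝ) :
    mean (stepsLaw μ α n) F =
      mean (labelsLaw α n) fun l => iidMean μ n fun y => F fun i => y (l i) := by
  induction n with
  | zero =>
    simp only [stepsLaw, labelsLaw, mean_pure, iidMean, Finset.univ_eq_empty, Finset.prod_empty,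
      one_mul, Fintype.sum_unique]
    exact congrArg F (Subsingleton.elim _ _)
  | succ n ih =>
    rw [mean_stepsLaw_succ, ih, mean_labelsLaw_succ]
    congr 1
    ext l
    have key : ∀ (y : Fin n → G) (g : G) (j : Fin (n + 1)),
        (fun i => (Fin.snoc y g : Fin (n + 1) → G)
          ((Fin.snoc (fun i => (l i).castSucc) j : Fin (n + 1) → Fin (n + 1)) i)) =
        (Fin.snoc (fun i => y (l i)) ((Fin.snoc y g : Fin (n + 1) → G) j) :
          Fin (n + 1) → G) := by
      intro y g j
      ext i
      refine Fin.lastCases ?_ (fun i => ?_) i <;> simp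
    simp only [iidMean_succ, key]
    cases n with
    | zero => simp only [nextStep, mean_pure, Fin.snoc_last]
    | succ n =>
      rw [mean_nextStep_succ, mean_pure]
      have hcast : ∀ (y : Fin (n + 1) → G) (g : G) (u : Fin (n + 1)),
          (Fin.snoc y g : Fin (n + 1 + 1) → G) u.castSucc = y u := fun y g u =>
        Fin.snoc_castSucc (α := fun _ => G) _ _ _
      have hlast : ∀ (y : Fin (n + 1) → G) (g : G),
          (Fin.snoc y g : Fin (n + 1 + 1) → G) (Fin.last (n + 1)) = g := fun y g =>
        Fin.snoc_last (α := fun _ => G) _ _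
      simp only [hcast, hlast, mean_const, mean_nextStep_succ]
      simp only [iidMean, mul_add, Finset.sum_add_distrib, Finset.mul_sum]
      congr 1
      · rw [Finset.sum_comm]
        refine Finset.sum_congr rfl fun u _ => Finset.sum_congr rfl fun y _ => by ring
      · refine Finset.sum_congr rfl fun y _ => by ring

end Clusters

/-! ### The number of odd clusters -/

/-- The number of steps that carry the label `j`. -/
def clusterSize {n : ℕ} (l : Fin n → Fin n) (j : Fin n) : ℕ :=
  ∑ i, if l i = j then 1 else 0

/-- The sum of `h` over the sizes of all clusters; labels that are not in use contribute `h 0`. -/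
def clusterSum (h : ℕ → ℝ) {n : ℕ} (l : Fin n → Fin n) : ℝ := ∑ j, h (clusterSize l j)

theorem sum_clusterSize {n : ℕ} (l : Fin n → Fin n) : ∑ j, clusterSize l j = n := by
  simp only [clusterSize]
  rw [Finset.sum_comm]
  simp

theorem sum_comp_label {n : ℕ} (l : Fin n → Fin n) (f : Fin n → ℝ) :
    ∑ i, f (l i) = ∑ j, (clusterSize l j : ℝ) * f j := by
  simp only [clusterSize, Nat.cast_sum, Finset.sum_mul]
  rw [Finset.sum_comm]
  simp

theorem clusterSize_snoc {n : ℕ} (l : Fin n → Fin n) (j k : Fin (n + 1)) :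
    clusterSize (Fin.snoc (fun i => (l i).castSucc) j : Fin (n + 1) → Fin (n + 1)) k =
      (∑ i, if (l i).castSucc = k then 1 else 0) + if j = k then 1 else 0 := by
  simp only [clusterSize, Fin.sum_univ_castSucc, Fin.snoc_castSucc, Fin.snoc_last]

theorem clusterSum_snoc_last (h : ℕ → ℝ) {n : ℕ} (l : Fin n → Fin n) :
    clusterSum h
        (Fin.snoc (fun i => (l i).castSucc) (Fin.last n) : Fin (n + 1) → Fin (n + 1)) =
      clusterSum h l + h 1 := by
  simp only [clusterSum, Fin.sum_univ_castSucc, clusterSize_snoc, Fin.castSucc_inj]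
  simp [clusterSize, Fin.castSucc_ne_last, (Fin.castSucc_ne_last _).symm]

theorem clusterSum_snoc_castSucc (h : ℕ → ℝ) (h0 : h 0 = 0) {n : ℕ} (l : Fin n → Fin n)
    (j : Fin n) :
    clusterSum h
        (Fin.snoc (fun i => (l i).castSucc) j.castSucc : Fin (n + 1) → Fin (n + 1)) =
      clusterSum h l + (h (clusterSize l j + 1) - h (clusterSize l j)) := by
  simp only [clusterSum, Fin.sum_univ_castSucc, clusterSize_snoc, Fin.castSucc_inj]
  simp only [Fin.castSucc_ne_last, if_false, Finset.sum_const_zero, add_zero, h0]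
  rw [← Finset.add_sum_erase _ _ (Finset.mem_univ j),
    ← Finset.add_sum_erase _ (fun k => h (clusterSize l k)) (Finset.mem_univ j)]
  have : ∀ k ∈ Finset.univ.erase j,
      h ((∑ i, if l i = k then 1 else 0) + if j = k then 1 else 0) = h (clusterSize l k) := by
    intro k hk
    rw [if_neg (Finset.ne_of_mem_erase hk).symm, add_zero, clusterSize]
  rw [Finset.sum_congr rfl this]
  simp only [if_true, clusterSize]
  ring

/-- If `h` is an eigenfunction, with eigenvalue `-m`, of the operator
`h ↦ (k ↦ k (h (k + 1) - h k))`, then the sum of `h` over the clusters is `n (1 - α) / (1 + α m)` up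
to a fluctuation of order `√n`: after centring, its expected increment given the past is `-α m / n` times its
current value, so that the second moment grows by at most a constant in each step. -/
theorem mean_clusterSum_sub_sq_le (α : unitInterval) (h : ℕ → ℝ) (m b : ℝ) (hm : 0 ≤ m)
    (h0 : h 0 = 0) (h1 : h 1 = 1)
    (heig : ∀ k : ℕ, k * (h (k + 1) - h k) = -m * h k) (hb1 : 1 ≤ b)
    (hb : ∀ k, |h (k + 1) - h k| ≤ b) (n : ℕ) :
    mean (labelsLaw α n) (fun l => (clusterSum h l - (1 - α) / (1 + α * m) * n) ^ 2) ≤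
      (b + 1) ^ 2 * n := by
  have hα0 : (0 : ℝ) ≤ α := α.2.1
  have hα1 : (α : ℝ) ≤ 1 := α.2.2
  have hpos : (0 : ℝ) < 1 + α * m := by positivity
  set κ : ℝ := (1 - α) / (1 + α * m) with hκ
  have hκeq : κ * (1 + α * m) = 1 - α := div_mul_cancel₀ _ hpos.ne'
  have hκ0 : 0 ≤ κ := div_nonneg (by linarith) hpos.le
  have hκ1 : κ ≤ 1 := by rw [hκ, div_le_one hpos]; nlinarith [mul_nonneg hα0 hm]
  induction n with
  | zero => simp [labelsLaw, mean_pure, clusterSum]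
  | succ n ih =>
    rw [mean_labelsLaw_succ]
    rcases n with _ | n
    · simp only [labelsLaw, mean_pure, nextStep, clusterSum_snoc_last]
      simp only [clusterSum, Finset.univ_eq_empty, Finset.sum_empty, h1]
      push_cast
      nlinarith
    · have step : ∀ l : Fin (n + 1) → Fin (n + 1),
          mean (nextStep (PMF.pure (Fin.last (n + 1))) α (n + 1) fun i => (l i).castSucc)
            (fun j => (clusterSum h
              (Fin.snoc (fun i => (l i).castSucc) j : Fin (n + 1 + 1) → Fin (n + 1 + 1)) -
                κ * ((n + 1 + 1 : ℕ) : ℝ)) ^ 2) ≤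
          (clusterSum h l - κ * ((n + 1 : ℕ) : ℝ)) ^ 2 + (b + 1) ^ 2 := by
        intro l
        rw [mean_nextStep_succ, mean_pure, clusterSum_snoc_last, h1]
        simp only [clusterSum_snoc_castSucc h h0]
        set N : ℝ := ((n + 1 : ℕ) : ℝ) with hN
        have hN2 : ((n + 1 + 1 : ℕ) : ℝ) = N + 1 := by rw [hN]; push_cast; ring
        have hNpos : 0 < N := by rw [hN]; positivity
        rw [hN2]
        set D : ℝ := clusterSum h l - κ * N with hD
        set Δ : Fin (n + 1) → ℝ := fun u =>
          h (clusterSize l (l u) + 1) - h (clusterSize l (l u)) with hΔ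
        have hsum : ∑ u, Δ u = -m * clusterSum h l := by
          rw [hΔ, sum_comp_label l fun j => h (clusterSize l j + 1) - h (clusterSize l j)]
          simp only [heig, clusterSum, Finset.mul_sum]
        have hsum2 : ∑ u, (D + (Δ u - κ)) ^ 2 ≤
            N * D ^ 2 + 2 * D * (-m * clusterSum h l - N * κ) + N * (b + 1) ^ 2 := by
          have : ∀ u, (D + (Δ u - κ)) ^ 2 ≤ D ^ 2 + 2 * D * (Δ u - κ) + (b + 1) ^ 2 := by
            intro u
            have hu := abs_le.1 (hb (clusterSize l (l u)))
            have : (Δ u - κ) ^ 2 ≤ (b + 1) ^ 2 :=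
              sq_le_sq' (by simp only [hΔ]; linarith) (by simp only [hΔ]; linarith)
            linarith [add_sq D (Δ u - κ)]
          refine (Finset.sum_le_sum fun u _ => this u).trans_eq ?_
          simp only [Finset.sum_add_distrib, ← Finset.mul_sum, Finset.sum_sub_distrib, hsum,
            Finset.sum_const, Finset.card_univ, Fintype.card_fin, nsmul_eq_mul, ← hN]
        have hlast : (D + (1 - κ)) ^ 2 ≤ D ^ 2 + 2 * D * (1 - κ) + (b + 1) ^ 2 := by
          nlinarith
        have e1 : ∀ u, clusterSum h l +
            (h (clusterSize l (l u) + 1) - h (clusterSize l (l u))) - κ * (N + 1) =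
              D + (Δ u - κ) := fun u => by simp only [hD, hΔ]; ring
        have e2 : clusterSum h l + 1 - κ * (N + 1) = D + (1 - κ) := by rw [hD]; ring
        simp only [e1, e2]
        have hH : clusterSum h l = D + κ * N := by rw [hD]; ring
        calc α * (N⁻¹ * ∑ u, (D + (Δ u - κ)) ^ 2) + (1 - α) * (D + (1 - κ)) ^ 2
            ≤ α * (N⁻¹ * (N * D ^ 2 + 2 * D * (-m * clusterSum h l - N * κ) +
                N * (b + 1) ^ 2)) + (1 - α) * (D ^ 2 + 2 * D * (1 - κ) + (b + 1) ^ 2) := by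
              have : (0 : ℝ) ≤ 1 - α := by linarith
              gcongr
          _ = D ^ 2 + (b + 1) ^ 2 - 2 * (α * m * D ^ 2 / N) +
                2 * D * ((1 - α) - κ * (1 + α * m)) := by
              rw [hH]; field_simp; ring
          _ ≤ D ^ 2 + (b + 1) ^ 2 := by
              rw [hκeq, sub_self, mul_zero, add_zero]
              have : 0 ≤ α * m * D ^ 2 / N := by positivity
              linarith
      refine (mean_mono _ step).trans ?_
      rw [mean_add, mean_const]
      push_cast at ih ⊢
      linarith

/-- The eigenfunctions, with eigenvalue `-m`, of the operator `h ↦ (k ↦ k (h (k + 1) - h k))`,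
extended by `0` to the empty cluster. -/
def eigenfun (m k : ℕ) : ℝ :=
  if k = 0 then 0 else if m = 0 then 1 else (-1) ^ (k - 1) * (m - 1).choose (k - 1)

theorem eigenfun_zero (m : ℕ) : eigenfun m 0 = 0 := by simp [eigenfun]

theorem eigenfun_one (m : ℕ) : eigenfun m 1 = 1 := by simp [eigenfun]

theorem eigenfun_eigen (m k : ℕ) :
    (k : ℝ) * (eigenfun m (k + 1) - eigenfun m k) = -(m : ℝ) * eigenfun m k := by
  rcases k with _ | k
  · simp [eigenfun]
  rcases m with _ | m
  · simp [eigenfun]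
  simp only [eigenfun, Nat.add_one_ne_zero, if_false, Nat.add_sub_cancel]
  have h1 : (((m + 1).choose (k + 1) : ℕ) : ℝ) = m.choose k + m.choose (k + 1) := by
    rw [Nat.choose_succ_succ]; push_cast; ring
  have h2 : ((m + 1 : ℕ) : ℝ) * m.choose k = (m + 1).choose (k + 1) * ((k + 1 : ℕ) : ℝ) := by
    exact_mod_cast Nat.add_one_mul_choose_eq m k
  rw [pow_succ]
  linear_combination (-1 : ℝ) ^ k * h2 + (-1 : ℝ) ^ k * ((k + 1 : ℕ) : ℝ) * h1

theorem abs_eigenfun_le (m k : ℕ) : |eigenfun m k| ≤ 2 ^ m := by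
  rw [eigenfun]
  split_ifs with h1 h2
  · simp
  · simp [h2]
  · rw [abs_mul, abs_pow, abs_neg, abs_one, one_pow, one_mul, Nat.abs_cast]
    have := (Nat.choose_le_two_pow (m - 1) (k - 1)).trans
      (Nat.pow_le_pow_right (by norm_num) (Nat.sub_le m 1))
    exact_mod_cast this

/-- The indicator function of the odd numbers. -/
def oddInd (k : ℕ) : ℝ := if Odd k then 1 else 0

theorem hasSum_choose_half (k : ℕ) : HasSum (fun m => (m.choose k : ℝ) * (1 / 2) ^ m) 2 := by
  have hg : HasSum (fun m => ((m + k).choose k : ℝ) * (1 / 2) ^ m) (1 / (1 - 1 / 2) ^ (k + 1)) :=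
    hasSum_choose_mul_geometric_of_norm_lt_one k (by norm_num)
  rw [← hasSum_nat_add_iff' k]
  have hz : ∑ i ∈ Finset.range k, (i.choose k : ℝ) * (1 / 2) ^ i = 0 :=
    Finset.sum_eq_zero fun i hi => by
      rw [Nat.choose_eq_zero_of_lt (Finset.mem_range.1 hi)]; simp
  have hv : (1 / (1 - 1 / 2) ^ (k + 1) : ℝ) * (1 / 2) ^ k = 2 := by
    rw [show (1 - 1 / 2 : ℝ) = 1 / 2 by norm_num, pow_succ]; field_simp
  have h := hg.mul_right ((1 / 2 : ℝ) ^ k)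
  rw [hv] at h
  rw [hz, sub_zero]
  refine h.congr_fun fun m => ?_
  rw [pow_add, mul_assoc]

/-- Expansion of the parity in the eigenfunctions: for `k ≥ 1` the sum of the terms with `m ≥ 1` is
`-(-1) ^ k / 2`, by the negative binomial series at `1 / 2`. -/
theorem hasSum_eigenfun (k : ℕ) :
    HasSum (fun m => (1 / 2 : ℝ) ^ m * eigenfun m k / 2) (oddInd k) := by
  rcases k with _ | k
  · simp [eigenfun, oddInd]
  rw [← hasSum_nat_add_iff' 1]
  have hv : oddInd (k + 1) - ∑ m ∈ Finset.range 1, (1 / 2 : ℝ) ^ m * eigenfun m (k + 1) / 2 =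
      2 * ((-1 : ℝ) ^ k / 4) := by
    rcases Nat.even_or_odd k with hk | hk
    · have : Odd (k + 1) := hk.add_one
      simp [eigenfun, oddInd, this, hk.neg_one_pow]; norm_num
    · have : ¬ Odd (k + 1) := by rw [Nat.not_odd_iff_even]; exact hk.add_one
      simp [eigenfun, oddInd, this, hk.neg_one_pow]; norm_num
  rw [hv]
  refine ((hasSum_choose_half k).mul_right ((-1 : ℝ) ^ k / 4)).congr_fun fun m => ?_
  simp only [eigenfun, Nat.add_one_ne_zero, if_false, Nat.add_sub_cancel, pow_succ]
  ring

/-- Partial sums of the expansion of the parity are bounded uniformly in the cluster size. -/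
theorem abs_sum_eigenfun_le (M k : ℕ) :
    |∑ m ∈ Finset.range M, (1 / 2 : ℝ) ^ m * eigenfun m k / 2| ≤ 1 := by
  rcases k with _ | k
  · simp [eigenfun]
  have h : HasSum (fun m => |(1 / 2 : ℝ) ^ m * eigenfun m (k + 1) / 2|) 1 := by
    rw [← hasSum_nat_add_iff' 1]
    have hv : 1 - ∑ m ∈ Finset.range 1, |(1 / 2 : ℝ) ^ m * eigenfun m (k + 1) / 2| =
        2 * (1 / 4) := by
      simp [eigenfun]; norm_num
    rw [hv]
    refine ((hasSum_choose_half k).mul_right (1 / 4)).congr_fun fun m => ?_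
    simp only [eigenfun, Nat.add_one_ne_zero, if_false, Nat.add_sub_cancel, abs_div, abs_mul,
      abs_pow, abs_neg, abs_one, one_pow, one_mul, Nat.abs_cast, pow_succ]
    norm_num
    ring
  exact (Finset.abs_sum_le_sum_abs _ _).trans (sum_le_hasSum _ (fun _ _ => abs_nonneg _) h)

/-- The truncation error of the expansion of the parity is small relative to the cluster size,
uniformly. This makes it summable over clusters, as the sizes of `n` steps add up to `n`. -/
theorem eventually_abs_oddInd_sub_le {θ : ℝ} (hθ : 0 < θ) :
    ∀ᶠ M in atTop, ∀ k : ℕ,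
      |oddInd k - ∑ m ∈ Finset.range M, (1 / 2 : ℝ) ^ m * eigenfun m k / 2| ≤ θ * k := by
  obtain ⟨K, hK⟩ := exists_nat_ge (2 / θ)
  have hsmall : ∀ᶠ M in atTop, ∀ k ∈ Finset.range K,
      |oddInd k - ∑ m ∈ Finset.range M, (1 / 2 : ℝ) ^ m * eigenfun m k / 2| ≤ θ := by
    rw [Filter.eventually_all_finset]
    intro k _
    have h := (hasSum_eigenfun k).tendsto_sum_nat.const_sub (oddInd k)
    rw [sub_self] at h
    have h' := h.abs
    rw [abs_zero] at h'
    exact h'.eventually (ge_mem_nhds hθ)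
  filter_upwards [hsmall] with M hM k
  rcases Nat.eq_zero_or_pos k with rfl | hk
  · simp [oddInd, eigenfun]
  rcases lt_or_ge k K with hkK | hkK
  · refine (hM k (Finset.mem_range.2 hkK)).trans (le_mul_of_one_le_right hθ.le ?_)
    exact_mod_cast hk
  · have h1 : |oddInd k| ≤ 1 := by rw [oddInd]; split_ifs <;> simp
    have h2 : 2 ≤ θ * k := by
      rw [div_le_iff₀' hθ] at hK
      exact hK.trans (by gcongr)
    exact (abs_sub _ _).trans (by linarith [abs_sum_eigenfun_le M k])

/-- The asymptotic density of odd clusters, that is, the limit of the number of odd clusters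
among `n` steps, divided by `n`. -/
def oddRate (α : unitInterval) : ℝ :=
  ∑' m : ℕ, (1 / 2 : ℝ) ^ m * ((1 - α) / (1 + α * m)) / 2

theorem ratio_mem (α : unitInterval) (m : ℕ) :
    0 ≤ (1 - α : ℝ) / (1 + α * m) ∧ (1 - α : ℝ) / (1 + α * m) ≤ 1 - α := by
  have h0 : (0 : ℝ) ≤ α := α.2.1
  have h1 : (0 : ℝ) ≤ 1 - α := sub_nonneg.2 α.2.2
  have hp : (1 : ℝ) ≤ 1 + α * m := le_add_of_nonneg_right (by positivity)
  exact ⟨div_nonneg h1 (by linarith), div_le_self h1 hp⟩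

theorem hasSum_half_pow_div_two : HasSum (fun m : ℕ => (1 / 2 : ℝ) ^ m / 2) 1 := by
  simpa using hasSum_geometric_two.div_const 2

theorem summable_oddRate (α : unitInterval) :
    Summable fun m : ℕ => (1 / 2 : ℝ) ^ m * ((1 - α) / (1 + α * m)) / 2 := by
  refine Summable.of_nonneg_of_le (fun m => ?_) (fun m => ?_) hasSum_half_pow_div_two.summable
  · have := (ratio_mem α m).1
    positivity
  · have h1 : (1 - α : ℝ) / (1 + α * m) ≤ 1 := (ratio_mem α m).2.trans (by linarith [α.2.1])
    have : (0 : ℝ) ≤ (1 / 2) ^ m := by positivity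
    nlinarith

/-- The number of odd clusters. -/
def oddCount {n : ℕ} (l : Fin n → Fin n) : ℕ := ∑ j, if Odd (clusterSize l j) then 1 else 0

theorem cast_oddCount {n : ℕ} (l : Fin n → Fin n) : (oddCount l : ℝ) = clusterSum oddInd l := by
  simp [oddCount, clusterSum, oddInd]

/-- Law of large numbers for the number of odd clusters. -/
theorem eventually_mean_oddCount_le (α : unitInterval) {δ ρ : ℝ} (hδ : 0 < δ) (hρ : 0 < ρ) :
    ∀ᶠ n : ℕ in atTop, mean (labelsLaw α n)
      (fun l => if δ * n < |(oddCount l : ℝ) - oddRate α * n| then 1 else 0) ≤ ρ := by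
  have htail : ∀ᶠ M in atTop, |oddRate α - ∑ m ∈ Finset.range M,
      (1 / 2 : ℝ) ^ m * ((1 - α) / (1 + α * m)) / 2| ≤ δ / 4 := by
    have h := ((summable_oddRate α).hasSum.tendsto_sum_nat.const_sub (oddRate α)).abs
    rw [oddRate, sub_self, abs_zero] at h
    exact h.eventually (ge_mem_nhds (by positivity))
  obtain ⟨M, hM1, hM2⟩ :=
    ((eventually_abs_oddInd_sub_le (show 0 < δ / 4 by positivity)).and htail).exists
  set κ : ℕ → ℝ := fun m => (1 - α) / (1 + α * m) with hκ
  set C : ℝ := M * ∑ m ∈ Finset.range M, ((2 : ℝ) ^ (m + 1) + 1) ^ 2 with hC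
  have hlarge : ∀ᶠ n : ℕ in atTop, 4 * C / (δ ^ 2 * ρ) ≤ n :=
    tendsto_natCast_atTop_atTop.eventually_ge_atTop _
  filter_upwards [hlarge, eventually_gt_atTop 0] with n hn hn0
  have hnpos : (0 : ℝ) < n := by exact_mod_cast hn0
  -- the centred sum over the first `M` eigenfunctions
  set T : (Fin n → Fin n) → ℝ := fun l => ∑ m ∈ Finset.range M,
    (1 / 2 : ℝ) ^ m / 2 * (clusterSum (eigenfun m) l - κ m * n) with hT
  have hclose : ∀ l, |(oddCount l : ℝ) - oddRate α * n| ≤ |T l| + δ / 2 * n := by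
    intro l
    have e : (oddCount l : ℝ) - oddRate α * n =
        (∑ j, (oddInd (clusterSize l j) - ∑ m ∈ Finset.range M,
          (1 / 2 : ℝ) ^ m * eigenfun m (clusterSize l j) / 2)) + T l -
        (oddRate α - ∑ m ∈ Finset.range M, (1 / 2 : ℝ) ^ m * κ m / 2) * n := by
      rw [cast_oddCount, hT]
      simp only [clusterSum, Finset.sum_sub_distrib, mul_sub, sub_mul, Finset.mul_sum,
        Finset.sum_mul]
      rw [Finset.sum_comm]
      have e1 : ∀ m j, (1 / 2 : ℝ) ^ m * eigenfun m (clusterSize l j) / 2 =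
        (1 / 2 : ℝ) ^ m / 2 * eigenfun m (clusterSize l j) := fun m j => by ring
      have e2 : ∀ m, (1 / 2 : ℝ) ^ m * κ m / 2 * n = (1 / 2 : ℝ) ^ m / 2 * (κ m * n) :=
        fun m => by ring
      simp only [e1, e2]
      ring
    have h1 : |∑ j, (oddInd (clusterSize l j) - ∑ m ∈ Finset.range M,
        (1 / 2 : ℝ) ^ m * eigenfun m (clusterSize l j) / 2)| ≤ δ / 4 * n := by
      refine (Finset.abs_sum_le_sum_abs _ _).trans
        ((Finset.sum_le_sum fun j _ => hM1 _).trans_eq ?_)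
      rw [← Finset.mul_sum, ← Nat.cast_sum, sum_clusterSize]
    have h2 : |(oddRate α - ∑ m ∈ Finset.range M, (1 / 2 : ℝ) ^ m * κ m / 2) * n| ≤
        δ / 4 * n := by
      rw [abs_mul, Nat.abs_cast]
      gcongr
    rw [e]
    refine (abs_sub _ _).trans ((add_le_add (abs_add_le _ _) le_rfl).trans ?_)
    linarith
  have hT2 : mean (labelsLaw α n) (fun l => T l ^ 2) ≤ C * n := by
    have h1 : ∀ l, T l ^ 2 ≤ M * ∑ m ∈ Finset.range M,
        (clusterSum (eigenfun m) l - κ m * n) ^ 2 := by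
      intro l
      refine (sq_sum_le_card_mul_sum_sq (s := Finset.range M)).trans ?_
      rw [Finset.card_range]
      refine mul_le_mul_of_nonneg_left (Finset.sum_le_sum fun m _ => ?_) (Nat.cast_nonneg M)
      rw [mul_pow]
      refine mul_le_of_le_one_left (sq_nonneg _) (pow_le_one₀ (by positivity) ?_)
      have : (1 / 2 : ℝ) ^ m ≤ 1 := pow_le_one₀ (by norm_num) (by norm_num)
      linarith
    refine (mean_mono _ h1).trans ?_
    rw [mean_const_mul, mean_sum, hC, mul_assoc, Finset.sum_mul]
    gcongr with m _
    refine mean_clusterSum_sub_sq_le α (eigenfun m) m (2 ^ (m + 1)) (by positivity)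
      (eigenfun_zero m) (eigenfun_one m) (eigenfun_eigen m) (one_le_pow₀ (by norm_num))
      (fun k => ?_) n
    refine (abs_sub _ _).trans ?_
    rw [pow_succ]
    linarith [abs_eigenfun_le m (k + 1), abs_eigenfun_le m k]
  have hind : ∀ l, (if δ * n < |(oddCount l : ℝ) - oddRate α * n| then (1 : ℝ) else 0) ≤
      (4 / (δ * n) ^ 2) * T l ^ 2 := by
    intro l
    split_ifs with h
    · have h2 : δ * n / 2 ≤ |T l| := by linarith [hclose l]
      have h3 : (δ * n / 2) ^ 2 ≤ T l ^ 2 := by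
        rw [← sq_abs (T l)]
        gcongr
      rw [div_mul_eq_mul_div, one_le_div (by positivity)]
      linarith
    · positivity
  refine (mean_mono _ hind).trans ?_
  rw [mean_const_mul]
  calc 4 / (δ * n) ^ 2 * mean (labelsLaw α n) (fun l => T l ^ 2)
      ≤ 4 / (δ * n) ^ 2 * (C * n) := by gcongr
    _ = 4 * C / (δ ^ 2 * n) := by field_simp
    _ ≤ ρ := by
      rw [div_le_iff₀ (by positivity)] at hn ⊢
      linarith

/-! ### Characters of the hypercube -/

/-- The sign `(-1)^b` of a bit. -/
def bitSign (b : ZMod 2) : ℝ := if b = 0 then 1 else -1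

theorem bitSign_add (a b : ZMod 2) : bitSign (a + b) = bitSign a * bitSign b := by
  revert a b
  have : ∀ a : ZMod 2, a = 0 ∨ a = 1 := by decide
  intro a b
  rcases this a with rfl | rfl <;> rcases this b with rfl | rfl <;>
    simp [bitSign, show (1 : ZMod 2) + 1 = 0 from rfl]

theorem bitSign_sq (a : ZMod 2) : bitSign a ^ 2 = 1 := by
  rw [bitSign]; split_ifs <;> norm_num

section Hypercube

variable {d : ℕ}

/-- The character of `ℤ₂^d` attached to a set of coordinates. -/
def character (A : Finset (Fin d)) (g : Fin d → ZMod 2) : ℝ := ∏ i ∈ A, bitSign (g i)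

theorem character_zero (A : Finset (Fin d)) : character A 0 = 1 := by
  simp [character, bitSign]

theorem character_add (A : Finset (Fin d)) (g g' : Fin d → ZMod 2) :
    character A (g + g') = character A g * character A g' := by
  simp [character, bitSign_add, Finset.prod_mul_distrib]

theorem character_sq (A : Finset (Fin d)) (g : Fin d → ZMod 2) : character A g ^ 2 = 1 := by
  simp [character, ← Finset.prod_pow, bitSign_sq]

theorem character_sum (A : Finset (Fin d)) {I : Type*} (s : Finset I)
    (g : I → Fin d → ZMod 2) : character A (∑ i ∈ s, g i) = ∏ i ∈ s, character A (g i) := by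
  classical
  induction s using Finset.induction_on with
  | empty => simp [character_zero]
  | insert i s hi ih => rw [Finset.sum_insert hi, Finset.prod_insert hi, character_add, ih]

theorem sum_character_of_nonempty {A : Finset (Fin d)} (hA : A.Nonempty) :
    ∑ g, character A g = 0 := by
  obtain ⟨i, hi⟩ := hA
  -- translating by the basis vector `e_i` flips the sign of the character
  have h1 : character A (Pi.single i 1) = -1 := by
    rw [character, Finset.prod_eq_single_of_mem i hi]
    · simp [bitSign]
    · intro j _ hj
      simp [bitSign, Pi.single_eq_of_ne hj]
  have h2 : ∑ g, character A (Pi.single i 1 + g) = ∑ g, character A g :=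
    Fintype.sum_equiv (Equiv.addLeft (Pi.single i 1 : Fin d → ZMod 2)) _ _ fun _ => rfl
  simp only [character_add, h1, ← Finset.mul_sum] at h2
  linarith

theorem sum_character_mul (g g' : Fin d → ZMod 2) :
    ∑ A, character A g * character A g' = if g = g' then (2 : ℝ) ^ d else 0 := by
  have h : ∑ A : Finset (Fin d), character A g * character A g' =
      ∏ i, (1 + bitSign (g i) * bitSign (g' i)) := by
    rw [Finset.prod_one_add, Finset.powerset_univ]
    simp [character, Finset.prod_mul_distrib]
  rw [h]
  split_ifs with hg
  · subst hg
    simp only [← pow_two, bitSign_sq]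
    norm_num
  · obtain ⟨i, hi⟩ := Function.ne_iff.1 hg
    refine Finset.prod_eq_zero (Finset.mem_univ i) ?_
    have : ∀ a b : ZMod 2, a ≠ b → (a = 0 ∧ b = 1) ∨ (a = 1 ∧ b = 0) := by decide
    rcases this _ _ hi with ⟨h1, h2⟩ | ⟨h1, h2⟩ <;> simp [h1, h2, bitSign]

/-- Plancherel identity on `ℤ₂^d`. -/
theorem two_pow_mul_sum_sq (φ : (Fin d → ZMod 2) → ℝ) :
    (2 : ℝ) ^ d * ∑ g, φ g ^ 2 = ∑ A, (∑ g, φ g * character A g) ^ 2 := by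
  have h : ∀ A : Finset (Fin d), (∑ g, φ g * character A g) ^ 2 =
      ∑ g, ∑ g', φ g * φ g' * (character A g * character A g') := by
    intro A
    rw [pow_two, Finset.sum_mul_sum]
    exact Finset.sum_congr rfl fun g _ => Finset.sum_congr rfl fun g' _ => by ring
  simp only [h]
  rw [Finset.sum_comm, Finset.mul_sum]
  refine Finset.sum_congr rfl fun g _ => ?_
  rw [Finset.sum_comm]
  simp only [← Finset.mul_sum, sum_character_mul]
  simp
  ring

theorem mean_lazyStep_character (hd : 1 ≤ d) (A : Finset (Fin d)) :
    mean (lazyStep d) (character A) = 1 - (A.card : ℝ) / d := by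
  obtain ⟨d, rfl⟩ := Nat.exists_eq_add_of_le' hd
  have hs : ∀ k, character A (Pi.single k 1) = 1 - 2 * if k ∈ A then 1 else 0 := by
    intro k
    split_ifs with hk
    · rw [character, Finset.prod_eq_single_of_mem k hk]
      · simp [bitSign]; norm_num
      · intro j _ hj
        simp [bitSign, Pi.single_eq_of_ne hj]
    · rw [character, Finset.prod_eq_one]
      · norm_num
      · intro j hj
        have : j ≠ k := fun e => hk (e ▸ hj)
        simp [bitSign, Pi.single_eq_of_ne this]
  simp only [lazyStep, mean_bind, mean_coin, if_true, Bool.false_eq_true, if_false, mean_map,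
    mean_uniform, mean_pure, character_zero, hs]
  rw [Finset.sum_sub_distrib, ← Finset.mul_sum]
  simp [half]
  field_simp
  ring

/-! ### The walk given its clusters -/

/-- The expectation of a function of the position of the walk, given the cluster labels. -/
def labelMean {n : ℕ} (l : Fin n → Fin n) (f : (Fin d → ZMod 2) → ℝ) : ℝ :=
  iidMean (lazyStep d) n fun y => f (∑ i, y (l i))

/-- The conditional law of the position of the walk given the cluster labels. -/
def labelProb {n : ℕ} (l : Fin n → Fin n) (g : Fin d → ZMod 2) : ℝ :=
  labelMean l fun g' => if g' = g then 1 else 0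

theorem labelProb_nonneg {n : ℕ} (l : Fin n → Fin n) (g : Fin d → ZMod 2) :
    0 ≤ labelProb l g :=
  iidMean_nonneg _ _ _ fun y => by dsimp only; split_ifs <;> norm_num

theorem labelMean_eq_sum {n : ℕ} (l : Fin n → Fin n) (f : (Fin d → ZMod 2) → ℝ) :
    labelMean l f = ∑ g, labelProb l g * f g := by
  simp only [labelProb, labelMean, iidMean, Finset.sum_mul]
  rw [Finset.sum_comm]
  simp

theorem walkLaw_eq_mean (α : unitInterval) (n : ℕ) (g : Fin d → ZMod 2) :
    (walkLaw (lazyStep d) α n g).toReal = mean (labelsLaw α n) fun l => labelProb l g := by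
  rw [toReal_apply_eq_mean, walkLaw, mean_map, mean_stepsLaw]
  rfl

theorem sum_comp_label_nsmul {M : Type*} [AddCommMonoid M] {n : ℕ} (l : Fin n → Fin n)
    (y : Fin n → M) : ∑ i, y (l i) = ∑ j, clusterSize l j • y j := by
  simp only [clusterSize, Finset.sum_smul]
  rw [Finset.sum_comm]
  simp

/-- A cluster contributes to the position of the walk if and only if its size is odd, so that
the conditional characteristic function is a power of that of a single step. -/
theorem labelMean_character (hd : 1 ≤ d) {n : ℕ} (l : Fin n → Fin n) (A : Finset (Fin d)) :
    labelMean l (character A) = (1 - (A.card : ℝ) / d) ^ oddCount l := by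
  have h : ∀ y : Fin n → Fin d → ZMod 2, character A (∑ i, y (l i)) =
      ∏ j, character A (y j) ^ (if Odd (clusterSize l j) then 1 else 0) := by
    intro y
    rw [sum_comp_label_nsmul, character_sum]
    refine Finset.prod_congr rfl fun j _ => ?_
    have h1 : ∀ k : ℕ, character A (k • y j) = character A (y j) ^ k := by
      intro k
      induction k with
      | zero => simp [character_zero]
      | succ k ih => rw [succ_nsmul, character_add, ih, pow_succ]
    rw [h1]
    split_ifs with ho
    · obtain ⟨r, hr⟩ := ho
      rw [hr, pow_succ, pow_mul, character_sq, one_pow, one_mul, pow_one]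
    · obtain ⟨r, hr⟩ := Nat.not_odd_iff_even.1 ho
      rw [hr, ← two_mul, pow_mul, character_sq, one_pow, pow_zero]
  simp only [labelMean, iidMean, h, ← Finset.prod_mul_distrib]
  rw [← Fintype.piFinset_univ, Finset.sum_prod_piFinset (s := Finset.univ)
    (g := fun j g => ((lazyStep d) g).toReal *
      character A g ^ (if Odd (clusterSize l j) then 1 else 0)), oddCount,
    ← Finset.prod_pow_eq_pow_sum]
  refine Finset.prod_congr rfl fun j _ => ?_
  split_ifs
  · simpa [mean] using mean_lazyStep_character hd A
  · simpa using sum_toReal (lazyStep d)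

theorem sum_labelProb (hd : 1 ≤ d) {n : ℕ} (l : Fin n → Fin n) :
    ∑ g : Fin d → ZMod 2, labelProb l g = 1 := by
  have h := labelMean_character hd l ∅
  rw [labelMean_eq_sum] at h
  simpa [character] using h

/-! ### Bounds on the total variation distance -/

theorem uniform_toReal (g : Fin d → ZMod 2) :
    (PMF.uniformOfFintype (Fin d → ZMod 2) g).toReal = ((2 : ℝ) ^ d)⁻¹ := by
  simp [ZMod.card]

/-- The second-moment bound on the conditional distance to uniformity. -/
theorem labelProb_dist_sq_le (hd : 1 ≤ d) {n : ℕ} (l : Fin n → Fin n) :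
    (∑ g : Fin d → ZMod 2, |labelProb l g - ((2 : ℝ) ^ d)⁻¹|) ^ 2 ≤
      Real.exp (d * Real.exp (-(2 * oddCount l / d))) - 1 := by
  have hd0 : (0 : ℝ) < d := by exact_mod_cast hd
  have h1 := sq_sum_le_card_mul_sum_sq (s := (Finset.univ : Finset (Fin d → ZMod 2)))
    (f := fun g => |labelProb l g - ((2 : ℝ) ^ d)⁻¹|)
  simp only [sq_abs, Finset.card_univ, Fintype.card_fun, ZMod.card, Fintype.card_fin,
    Nat.cast_pow, Nat.cast_ofNat] at h1
  rw [two_pow_mul_sum_sq] at h1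
  refine h1.trans ?_
  have hterm : ∀ A : Finset (Fin d),
      (∑ g, (labelProb l g - ((2 : ℝ) ^ d)⁻¹) * character A g) ^ 2 ≤
        Real.exp (-(2 * oddCount l / d)) ^ A.card - if A = ∅ then 1 else 0 := by
    intro A
    simp only [sub_mul, Finset.sum_sub_distrib, ← Finset.mul_sum]
    rw [← labelMean_eq_sum, labelMean_character hd]
    split_ifs with hA
    · subst hA
      simp [character, ZMod.card]
    · rw [sum_character_of_nonempty (Finset.nonempty_iff_ne_empty.2 hA), mul_zero, sub_zero,
        sub_zero, ← pow_mul, mul_comm, pow_mul, ← Real.exp_nat_mul]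
      have hc : (A.card : ℝ) / d ≤ 1 := by
        rw [div_le_one hd0]
        exact_mod_cast (Finset.card_le_univ A).trans_eq (Fintype.card_fin d)
      have h0 : 0 ≤ 1 - (A.card : ℝ) / d := by linarith
      calc ((1 - (A.card : ℝ) / d) ^ 2) ^ oddCount l
          ≤ (Real.exp (-(A.card / d)) ^ 2) ^ oddCount l := by
            gcongr
            exact Real.one_sub_le_exp_neg _
        _ = Real.exp (A.card * -(2 * oddCount l / d)) := by
            rw [← pow_mul, ← Real.exp_nat_mul]
            push_cast
            congr 1
            ring
  refine (Finset.sum_le_sum fun A _ => hterm A).trans ?_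
  rw [Finset.sum_sub_distrib]
  have hsum : ∑ A : Finset (Fin d), Real.exp (-(2 * oddCount l / d)) ^ A.card =
      (1 + Real.exp (-(2 * oddCount l / d))) ^ d := by
    have := Finset.prod_one_add (s := (Finset.univ : Finset (Fin d)))
      (f := fun _ => Real.exp (-(2 * oddCount l / d)))
    simpa using this.symm
  rw [hsum]
  have hexp : (1 + Real.exp (-(2 * oddCount l / d))) ^ d ≤
      Real.exp (d * Real.exp (-(2 * oddCount l / d))) := by
    rw [Real.exp_nat_mul]
    gcongr
    rw [add_comm]
    exact Real.add_one_le_exp _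
  simpa using hexp

/-- If the number of odd clusters is unlikely to be less than `N`, the walk is as close to
uniform as `N` steps without reinforcement. -/
theorem tvDist_le (hd : 1 ≤ d) (α : unitInterval) (n : ℕ) (N : ℝ) :
    tvDist (walkLaw (lazyStep d) α n) (PMF.uniformOfFintype (Fin d → ZMod 2)) ≤
      mean (labelsLaw α n) (fun l => if (oddCount l : ℝ) < N then 1 else 0) +
        Real.sqrt (Real.exp (d * Real.exp (-(2 * N / d))) - 1) / 2 := by
  have hd0 : (0 : ℝ) < d := by exact_mod_cast hd
  rw [← mean_const (labelsLaw α n) (Real.sqrt _ / 2), ← mean_add]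
  have h1 : ∀ g : Fin d → ZMod 2, (walkLaw (lazyStep d) α n g).toReal -
      (PMF.uniformOfFintype (Fin d → ZMod 2) g).toReal =
      mean (labelsLaw α n) fun l => labelProb l g - ((2 : ℝ) ^ d)⁻¹ := by
    intro g
    simp only [sub_eq_add_neg, mean_add, mean_const, walkLaw_eq_mean, uniform_toReal]
  simp only [tvDist, h1]
  refine (mul_le_mul_of_nonneg_left (Finset.sum_le_sum fun g _ => abs_mean_le _ _)
    (by norm_num)).trans ?_
  rw [← mean_sum, ← mean_const_mul]
  refine mean_mono _ fun l => ?_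
  split_ifs with hl
  · have : ∑ g : Fin d → ZMod 2, |labelProb l g - ((2 : ℝ) ^ d)⁻¹| ≤ 2 := by
      refine (Finset.sum_le_sum fun g _ => abs_sub (labelProb l g) _).trans ?_
      simp only [Finset.sum_add_distrib, abs_of_nonneg (labelProb_nonneg l _), sum_labelProb hd,
        abs_inv, abs_pow]
      simp [ZMod.card]
      norm_num
    have := Real.sqrt_nonneg (Real.exp (d * Real.exp (-(2 * N / d))) - 1)
    linarith
  · have h2 := Real.le_sqrt_of_sq_le (labelProb_dist_sq_le hd l)
    have h3 : Real.sqrt (Real.exp (d * Real.exp (-(2 * oddCount l / d))) - 1) ≤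
        Real.sqrt (Real.exp (d * Real.exp (-(2 * N / d))) - 1) := by
      push Not at hl
      gcongr
    linarith

/-- The sum of the signs of all coordinates. -/
def signSum (g : Fin d → ZMod 2) : ℝ := ∑ i, character {i} g

theorem signSum_sq (g : Fin d → ZMod 2) :
    signSum g ^ 2 = d + ∑ i, ∑ j ∈ Finset.univ.erase i, character {i, j} g := by
  rw [signSum, pow_two, Finset.sum_mul_sum]
  have : ∀ i, ∑ j, character {i} g * character {j} g =
      1 + ∑ j ∈ Finset.univ.erase i, character {i, j} g := by
    intro i
    rw [← Finset.add_sum_erase _ _ (Finset.mem_univ i), ← pow_two, character_sq]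
    congr 1
    refine Finset.sum_congr rfl fun j hj => ?_
    simp [character, Finset.prod_pair (Finset.ne_of_mem_erase hj).symm]
  simp [this, Finset.sum_add_distrib]

/-- If all coordinate signs have mean `t` and all products of two of them have mean at most `t ^ 2`,
the variance of `signSum` is at most `d`. -/
theorem sum_sq_signSum_sub_le (p : (Fin d → ZMod 2) → ℝ) (hp : ∑ g, p g = 1) (t : ℝ)
    (h1 : ∀ i, ∑ g, p g * character {i} g = t)
    (h2 : ∀ i j, i ≠ j → ∑ g, p g * character {i, j} g ≤ t ^ 2) :
    ∑ g, p g * (signSum g - d * t) ^ 2 ≤ d := by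
  have e1 : ∑ g, p g * signSum g = d * t := by
    simp only [signSum, Finset.mul_sum]
    rw [Finset.sum_comm]
    simp [h1]
  have e2 : ∑ g, p g * signSum g ^ 2 ≤ d + d * (d - 1) * t ^ 2 := by
    simp only [signSum_sq, mul_add, Finset.sum_add_distrib, ← Finset.sum_mul, hp, one_mul,
      Finset.mul_sum]
    rw [Finset.sum_comm]
    refine add_le_add le_rfl ?_
    have : ∀ i : Fin d, ∑ g, ∑ j ∈ Finset.univ.erase i, p g * character {i, j} g ≤
        (d - 1) * t ^ 2 := by
      intro i
      rw [Finset.sum_comm]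
      refine (Finset.sum_le_sum fun j hj =>
        h2 i j (Finset.ne_of_mem_erase hj).symm).trans_eq ?_
      have : 1 ≤ d := Fin.pos i
      simp [Finset.card_erase_of_mem, Nat.cast_sub this]
    refine (Finset.sum_le_sum fun i _ => this i).trans_eq ?_
    simp
    ring
  have e3 : ∑ g, p g * (signSum g - d * t) ^ 2 =
      ∑ g, p g * signSum g ^ 2 - 2 * (d * t) * ∑ g, p g * signSum g +
        (d * t) ^ 2 * ∑ g, p g := by
    simp only [Finset.mul_sum, ← Finset.sum_sub_distrib, ← Finset.sum_add_distrib]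
    exact Finset.sum_congr rfl fun g _ => by ring
  rw [e3, e1, hp]
  nlinarith [sq_nonneg t]

theorem sum_ite_le_of_second_moment (p : (Fin d → ZMod 2) → ℝ) (hp : ∀ g, 0 ≤ p g)
    (F : (Fin d → ZMod 2) → ℝ) (P : (Fin d → ZMod 2) → Prop) [DecidablePred P] {a v : ℝ}
    (ha : 0 < a) (hP : ∀ g, P g → a ≤ |F g|) (hv : ∑ g, p g * F g ^ 2 ≤ v) :
    ∑ g, p g * (if P g then 1 else 0) ≤ v / a ^ 2 := by
  rw [le_div_iff₀ (by positivity), Finset.sum_mul]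
  refine (Finset.sum_le_sum fun g _ => ?_).trans hv
  rw [mul_assoc]
  refine mul_le_mul_of_nonneg_left ?_ (hp g)
  split_ifs with h
  · rw [one_mul, ← sq_abs (F g)]
    have := hP g h
    gcongr
  · rw [zero_mul]; positivity

theorem sub_le_tvDist {A : Type*} [Fintype A] (p q : PMF A) (P : A → Prop) [DecidablePred P] :
    (∑ a, (p a).toReal * if P a then 1 else 0) - (∑ a, (q a).toReal * if P a then 1 else 0) ≤
      tvDist p q := by
  have h : ∀ a, (p a).toReal * (if P a then 1 else 0) - (q a).toReal * (if P a then 1 else 0) ≤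
      (1 / 2) * |(p a).toReal - (q a).toReal| + (1 / 2) * ((p a).toReal - (q a).toReal) := by
    intro a
    split_ifs
    · linarith [le_abs_self ((p a).toReal - (q a).toReal)]
    · linarith [neg_abs_le ((p a).toReal - (q a).toReal)]
  have h2 := Finset.sum_le_sum fun a (_ : a ∈ Finset.univ) => h a
  rw [Finset.sum_sub_distrib, Finset.sum_add_distrib, ← Finset.mul_sum, ← Finset.mul_sum,
    Finset.sum_sub_distrib, sum_toReal, sum_toReal, sub_self, mul_zero, add_zero] at h2
  exact h2

/-- If the number of odd clusters is unlikely to exceed `N`, the walk is as far from uniform as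
`N` steps without reinforcement; the sum of the coordinate signs tells the two laws apart. -/
theorem le_tvDist (hd : 2 ≤ d) (α : unitInterval) (n N : ℕ) :
    1 - mean (labelsLaw α n) (fun l => if N < oddCount l then 1 else 0) -
        8 / (d * ((1 - 1 / (d : ℝ)) ^ N) ^ 2) ≤
      tvDist (walkLaw (lazyStep d) α n) (PMF.uniformOfFintype (Fin d → ZMod 2)) := by
  have hd1 : 1 ≤ d := by omega
  have hd0 : (2 : ℝ) ≤ d := by exact_mod_cast hd
  set q : ℝ := 1 - 1 / (d : ℝ) with hq
  have hinv : 1 / (d : ℝ) ≤ 1 / 2 := one_div_le_one_div_of_le (by norm_num) hd0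
  have hinv0 : 0 < 1 / (d : ℝ) := by positivity
  have hq0 : 0 < q := by rw [hq]; linarith
  have hq1 : q ≤ 1 := by rw [hq]; linarith
  set a : ℝ := d * q ^ N / 2 with ha
  have ha0 : 0 < a := by positivity
  have hval : (d : ℝ) / a ^ 2 = 4 / (d * (q ^ N) ^ 2) := by
    rw [ha]; field_simp; norm_num
  refine le_trans ?_ (sub_le_tvDist _ _ fun g : Fin d → ZMod 2 => a < signSum g)
  -- the uniform law
  have hU : ∑ g : Fin d → ZMod 2, (PMF.uniformOfFintype (Fin d → ZMod 2) g).toReal *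
      (if a < signSum g then 1 else 0) ≤ 4 / (d * (q ^ N) ^ 2) := by
    rw [← hval]
    refine sum_ite_le_of_second_moment _ (fun g => ENNReal.toReal_nonneg)
      (fun g => signSum g - d * 0) _ ha0 (fun g hg => ?_) ?_
    · rw [mul_zero, sub_zero]
      exact hg.le.trans (le_abs_self _)
    · refine sum_sq_signSum_sub_le _ (sum_toReal _) 0 (fun i => ?_) fun i j _ => ?_
      · simp only [uniform_toReal, ← Finset.mul_sum,
          sum_character_of_nonempty (Finset.singleton_nonempty i), mul_zero]
      · simp only [uniform_toReal, ← Finset.mul_sum,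
          sum_character_of_nonempty (Finset.insert_nonempty i {j}), mul_zero]
        norm_num
  -- the conditional laws with few odd clusters
  have hl : ∀ l : Fin n → Fin n, 1 - (if N < oddCount l then 1 else 0) - 4 / (d * (q ^ N) ^ 2) ≤
      ∑ g : Fin d → ZMod 2, labelProb l g * (if a < signSum g then 1 else 0) := by
    intro l
    split_ifs with hN
    · have h1 : 0 ≤ ∑ g : Fin d → ZMod 2, labelProb l g * (if a < signSum g then 1 else 0) :=
        Finset.sum_nonneg fun g _ =>
          mul_nonneg (labelProb_nonneg l g) (by split_ifs <;> norm_num)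
      have h2 : 0 ≤ 4 / (d * (q ^ N) ^ 2) := by positivity
      linarith
    · push Not at hN
      have hqN : q ^ N ≤ q ^ oddCount l := pow_le_pow_of_le_one hq0.le hq1 hN
      have hvar : ∑ g : Fin d → ZMod 2, labelProb l g * (signSum g - d * q ^ oddCount l) ^ 2 ≤
          d := by
        refine sum_sq_signSum_sub_le _ (sum_labelProb hd1 l) _ (fun i => ?_) fun i j hij => ?_
        · rw [← labelMean_eq_sum, labelMean_character hd1]
          simp [hq]
        · rw [← labelMean_eq_sum, labelMean_character hd1, Finset.card_pair hij, ← pow_mul,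
            mul_comm, pow_mul]
          have e : (((2 : ℕ) : ℝ)) / d = 2 * (1 / d) := by push_cast; ring
          rw [e]
          refine pow_le_pow_left₀ (by linarith) ?_ _
          rw [hq]
          nlinarith
      have hcheb := sum_ite_le_of_second_moment (labelProb l) (labelProb_nonneg l)
        (fun g => signSum g - d * q ^ oddCount l) (fun g => ¬ a < signSum g) ha0
        (fun g hg => ?_) hvar
      · have hsplit : ∑ g : Fin d → ZMod 2, labelProb l g * (if a < signSum g then 1 else 0) +
            ∑ g : Fin d → ZMod 2, labelProb l g * (if ¬ a < signSum g then 1 else 0) = 1 := by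
          rw [← Finset.sum_add_distrib]
          refine (Finset.sum_congr rfl fun g _ => ?_).trans (sum_labelProb hd1 l)
          split_ifs <;> simp
        rw [hval] at hcheb
        linarith
      · push Not at hg
        have h1 : d * q ^ N ≤ d * q ^ oddCount l := by gcongr
        rw [abs_sub_comm]
        refine le_trans ?_ (le_abs_self _)
        linarith
  have hW : 1 - mean (labelsLaw α n) (fun l => if N < oddCount l then 1 else 0) -
      4 / (d * (q ^ N) ^ 2) ≤ ∑ g : Fin d → ZMod 2,
        (walkLaw (lazyStep d) α n g).toReal * (if a < signSum g then 1 else 0) := by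
    have h := mean_mono (labelsLaw α n) hl
    have e1 : mean (labelsLaw α n) (fun l => 1 - (if N < oddCount l then 1 else 0) -
        4 / (d * (q ^ N) ^ 2)) = 1 - mean (labelsLaw α n)
          (fun l => if N < oddCount l then 1 else 0) - 4 / (d * (q ^ N) ^ 2) := by
      have h3 := mean_const_mul (labelsLaw α n) (-1)
        (fun l => if N < oddCount l then 1 else 0)
      simp only [neg_one_mul] at h3
      simp only [sub_eq_add_neg, mean_add, mean_const, h3]
    have e2 : mean (labelsLaw α n) (fun l => ∑ g : Fin d → ZMod 2,
        labelProb l g * (if a < signSum g then 1 else 0)) = ∑ g : Fin d → ZMod 2,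
          (walkLaw (lazyStep d) α n g).toReal * (if a < signSum g then 1 else 0) := by
      rw [mean_sum]
      refine Finset.sum_congr rfl fun g _ => ?_
      rw [walkLaw_eq_mean]
      simp only [mul_comm _ (if a < signSum g then (1 : ℝ) else 0), mean_const_mul]
    rwa [e1, e2] at h
  have h8 : 8 / (d * (q ^ N) ^ 2) = 4 / (d * (q ^ N) ^ 2) + 4 / (d * (q ^ N) ^ 2) := by ring
  linarith

end Hypercube

/-! ### The density of odd clusters -/

theorem oddRate_le (α : unitInterval) : oddRate α ≤ 1 - α := by
  have h : HasSum (fun m : ℕ => (1 / 2 : ℝ) ^ m / 2 * (1 - α)) (1 * (1 - α)) :=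
    hasSum_half_pow_div_two.mul_right _
  rw [one_mul] at h
  refine hasSum_le (fun m => ?_) (summable_oddRate α).hasSum h
  rw [mul_div_right_comm]
  exact mul_le_mul_of_nonneg_left (ratio_mem α m).2 (by positivity)

theorem oddRate_zero : oddRate 0 = 1 := by
  have h : HasSum (fun m : ℕ => (1 / 2 : ℝ) ^ m / 2) 1 := hasSum_half_pow_div_two
  rw [oddRate]
  refine (tsum_congr fun m => ?_).trans h.tsum_eq
  simp

theorem oddRate_pos {α : unitInterval} (hα : (α : ℝ) < 1) : 0 < oddRate α := by
  have h := le_hasSum (summable_oddRate α).hasSum 0 fun m _ => by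
    have := (ratio_mem α m).1
    positivity
  refine lt_of_lt_of_le ?_ h
  have : 0 < 1 - (α : ℝ) := sub_pos.2 hα
  simpa using this

theorem ordinaryHypergeometric_eq_tsum_half {α : ℝ} (hα : 0 < α) :
    ordinaryHypergeometric (1 : ℝ) α⁻¹ (α⁻¹ + 1) (1 / 2 : ℝ) =
      ∑' m : ℕ, (1 / 2 : ℝ) ^ m / (1 + α * m) := by
  rw [ordinaryHypergeometric_eq_tsum]
  refine tsum_congr fun m => ?_
  have hb : 0 < α⁻¹ := inv_pos.2 hα
  have h1 : (ascPochhammer ℝ m).eval 1 = m.factorial := by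
    rw [ascPochhammer_eval_one]
  -- `(b)_m (b + m) = b (b + 1)_m`
  have h2 : (ascPochhammer ℝ m).eval α⁻¹ * (α⁻¹ + m) =
      α⁻¹ * (ascPochhammer ℝ m).eval (α⁻¹ + 1) := by
    rw [← ascPochhammer_succ_eval, ascPochhammer_succ_left]
    simp
  have h3 : 0 < (ascPochhammer ℝ m).eval (α⁻¹ + 1) := ascPochhammer_pos m _ (by linarith)
  have h4 : (0 : ℝ) < α⁻¹ + m := by positivity
  have h5 : (ascPochhammer ℝ m).eval α⁻¹ =
      α⁻¹ * (ascPochhammer ℝ m).eval (α⁻¹ + 1) / (α⁻¹ + m) := by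
    rw [eq_div_iff h4.ne', h2]
  have h6 : (m.factorial : ℝ) ≠ 0 := by exact_mod_cast m.factorial_ne_zero
  have h7 : (0 : ℝ) < 1 + α * m := by positivity
  rw [smul_eq_mul, h1, h5]
  generalize (ascPochhammer ℝ m).eval (α⁻¹ + 1) = x at h3
  field_simp

theorem two_mul_oddRate {α : unitInterval} (hα : (0 : ℝ) < α) :
    2 * oddRate α =
      (1 - (α : ℝ)) * ordinaryHypergeometric (1 : ℝ) (α : ℝ)⁻¹ ((α : ℝ)⁻¹ + 1) (1 / 2 : ℝ) := by
  rw [ordinaryHypergeometric_eq_tsum_half hα, oddRate, ← tsum_mul_left, ← tsum_mul_left]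
  exact tsum_congr fun m => by ring

/-! ### Asymptotics of the mixing time -/

theorem tendsto_natCast_mul_log : Tendsto (fun d : ℕ => (d : ℝ) * Real.log d) atTop atTop :=
  (tendsto_natCast_atTop_atTop (R := ℝ)).atTop_mul_atTop₀
    (Real.tendsto_log_atTop.comp tendsto_natCast_atTop_atTop)

theorem eventually_tvDist_le {α : unitInterval} {a ρ : ℝ} (ha : 0 < a)
    (har : 1 / 2 < a * oddRate α) (hρ : 0 < ρ) :
    ∀ᶠ d : ℕ in atTop, ∀ n : ℕ, a * (d * Real.log d) ≤ n →
      tvDist (walkLaw (lazyStep d) α n) (PMF.uniformOfFintype (Fin d → ZMod 2)) ≤ ρ := by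
  set r := oddRate α with hr
  obtain ⟨r', hr1, hr2⟩ : ∃ r', 1 / (2 * a) < r' ∧ r' < r := by
    refine exists_between ?_
    rw [div_lt_iff₀ (by positivity)]
    linarith
  have hr0 : 0 < r' := lt_trans (by positivity) hr1
  rw [div_lt_iff₀ (by positivity)] at hr1
  set s : ℝ := 2 * a * r' - 1 with hs
  have hs0 : 0 < s := by rw [hs]; linarith
  have hlim : Tendsto (fun d : ℕ => Real.sqrt (Real.exp (Real.exp (-(s * Real.log d))) - 1) / 2)
      atTop (𝓝 0) := by
    have h1 : Tendsto (fun d : ℕ => Real.exp (-(s * Real.log d))) atTop (𝓝 0) :=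
      Real.tendsto_exp_neg_atTop_nhds_zero.comp
        ((Real.tendsto_log_atTop.comp tendsto_natCast_atTop_atTop).const_mul_atTop hs0)
    have h2 : Continuous fun x : ℝ => Real.sqrt (Real.exp x - 1) / 2 := by fun_prop
    have h3 : Tendsto (fun x : ℝ => Real.sqrt (Real.exp x - 1) / 2) (𝓝 0) (𝓝 0) := by
      simpa using h2.tendsto 0
    exact h3.comp h1
  obtain ⟨n₀, hn₀⟩ := eventually_atTop.1
    (eventually_mean_oddCount_le α (sub_pos.2 hr2) (half_pos hρ))
  filter_upwards [hlim.eventually (ge_mem_nhds (half_pos hρ)), eventually_ge_atTop 1,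
    (tendsto_natCast_mul_log.const_mul_atTop ha).eventually_ge_atTop (n₀ : ℝ)]
    with d hd hd1 hdn n hn
  have hd0 : (0 : ℝ) < d := by exact_mod_cast hd1
  have hnn : n₀ ≤ n := by exact_mod_cast hdn.trans hn
  refine (tvDist_le hd1 α n (r' * (a * (d * Real.log d)))).trans ?_
  have h1 : mean (labelsLaw α n)
      (fun l => if (oddCount l : ℝ) < r' * (a * (d * Real.log d)) then 1 else 0) ≤ ρ / 2 := by
    refine (mean_mono _ fun l => ?_).trans (hn₀ n hnn)
    split_ifs with h h'
    · exact le_rfl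
    · refine absurd ?_ h'
      have h2 : (oddCount l : ℝ) < r' * n := h.trans_le (by gcongr)
      rw [abs_sub_comm]
      refine lt_of_lt_of_le ?_ (le_abs_self _)
      rw [sub_mul]
      linarith
    · norm_num
    · exact le_rfl
  have h2 : d * Real.exp (-(2 * (r' * (a * (d * Real.log d))) / d)) =
      Real.exp (-(s * Real.log d)) := by
    have : (d : ℝ) = Real.exp (Real.log d) := (Real.exp_log hd0).symm
    have e : 2 * (r' * (a * (d * Real.log d))) / d = (s + 1) * Real.log d := by
      rw [hs]; field_simp; ring
    rw [e]
    nth_rw 1 [this]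
    rw [← Real.exp_add]
    congr 1
    ring
  rw [h2]
  linarith

theorem eventually_lt_tvDist {α : unitInterval} {a ρ : ℝ} (ha : 0 < a) (hr0 : 0 < oddRate α)
    (har : a * oddRate α < 1 / 2) (hρ : ρ < 1) :
    ∀ᶠ d : ℕ in atTop, ρ < tvDist (walkLaw (lazyStep d) α ⌊a * (d * Real.log d)⌋₊)
      (PMF.uniformOfFintype (Fin d → ZMod 2)) := by
  set r := oddRate α with hr
  obtain ⟨r', hr1, hr2⟩ : ∃ r', r < r' ∧ r' < 1 / (2 * a) := by
    refine exists_between ?_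
    rw [lt_div_iff₀ (by positivity)]
    linarith
  have hr0' : 0 < r' := hr0.trans hr1
  rw [lt_div_iff₀ (by positivity)] at hr2
  set s : ℝ := 1 - 2 * a * r' with hs
  have hs0 : 0 < s := by rw [hs]; linarith
  have hs1 : 0 < 1 - s := by rw [hs]; ring_nf; positivity
  have hlim : Tendsto (fun d : ℕ => 8 * Real.exp (-(s ^ 2 * Real.log d))) atTop (𝓝 0) := by
    have h1 : Tendsto (fun d : ℕ => Real.exp (-(s ^ 2 * Real.log d))) atTop (𝓝 0) :=
      Real.tendsto_exp_neg_atTop_nhds_zero.comp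
        ((Real.tendsto_log_atTop.comp tendsto_natCast_atTop_atTop).const_mul_atTop (by positivity))
    simpa using h1.const_mul 8
  have hρ' : 0 < (1 - ρ) / 3 := by linarith
  obtain ⟨n₀, hn₀⟩ := eventually_atTop.1 (eventually_mean_oddCount_le α (sub_pos.2 hr1) hρ')
  filter_upwards [hlim.eventually (ge_mem_nhds hρ'), eventually_ge_atTop 2,
    (tendsto_natCast_atTop_atTop (R := ℝ)).eventually_ge_atTop (1 + 1 / s),
    (tendsto_natCast_mul_log.const_mul_atTop ha).eventually_ge_atTop (n₀ : ℝ)]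
    with d hd hd2 hds hdn
  have hd2' : (2 : ℝ) ≤ d := by exact_mod_cast hd2
  have hlog : 0 ≤ Real.log d := Real.log_nonneg (by linarith)
  set n := ⌊a * (d * Real.log d)⌋₊ with hn
  have hnn : n₀ ≤ n := Nat.le_floor hdn
  have hnle : (n : ℝ) ≤ a * (d * Real.log d) := Nat.floor_le (by positivity)
  set N := ⌊r' * n⌋₊ with hN
  have hNle : (N : ℝ) ≤ r' * n := Nat.floor_le (by positivity)
  have h1 : mean (labelsLaw α n) (fun l => if N < oddCount l then 1 else 0) ≤ (1 - ρ) / 3 := by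
    refine (mean_mono _ fun l => ?_).trans (hn₀ n hnn)
    split_ifs with h h'
    · exact le_rfl
    · refine absurd ?_ h'
      have h2 : r' * n < oddCount l := (Nat.floor_lt (by positivity)).1 h
      refine lt_of_lt_of_le ?_ (le_abs_self _)
      rw [sub_mul]
      linarith
    · norm_num
    · exact le_rfl
  have h2 : Real.exp (s ^ 2 * Real.log d) ≤ d * ((1 - 1 / (d : ℝ)) ^ N) ^ 2 := by
    have hq0 : 0 < 1 - 1 / (d : ℝ) := by
      have : 1 / (d : ℝ) ≤ 1 / 2 := one_div_le_one_div_of_le (by norm_num) hd2'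
      linarith
    have hq : Real.exp (-(1 / (d - 1))) ≤ 1 - 1 / (d : ℝ) := by
      rw [← Real.le_log_iff_exp_le hq0]
      refine le_trans (le_of_eq ?_) (Real.one_sub_inv_le_log_of_pos hq0)
      have hd1 : (d : ℝ) - 1 ≠ 0 := by linarith
      have hd0 : (d : ℝ) ≠ 0 := by linarith
      rw [show 1 - 1 / (d : ℝ) = (d - 1) / d by field_simp, inv_div]
      field_simp
      ring
    -- `d / (d - 1) ≤ 1 + s`
    have hfrac : 2 * N * (1 / ((d : ℝ) - 1)) ≤ (1 - s ^ 2) * Real.log d := by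
      have hd1 : 0 < (d : ℝ) - 1 := by linarith
      have e1 : (d : ℝ) ≤ (1 + s) * (d - 1) := by
        have : 1 ≤ (d - 1) * s := by
          rw [← div_le_iff₀ hs0]; linarith
        linarith
      have e2 : 2 * (N : ℝ) ≤ (1 - s) * (d * Real.log d) := by
        have : r' * n ≤ r' * (a * (d * Real.log d)) := by gcongr
        rw [hs]
        linarith
      rw [mul_one_div, div_le_iff₀ hd1]
      calc 2 * (N : ℝ) ≤ (1 - s) * (d * Real.log d) := e2
        _ ≤ (1 - s) * ((1 + s) * (d - 1) * Real.log d) := by gcongr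
        _ = (1 - s ^ 2) * Real.log d * (d - 1) := by ring
    calc Real.exp (s ^ 2 * Real.log d)
        ≤ Real.exp (Real.log d + -(2 * N * (1 / ((d : ℝ) - 1)))) := by
          rw [Real.exp_le_exp]; linarith
      _ = d * (Real.exp (-(1 / ((d : ℝ) - 1))) ^ N) ^ 2 := by
          rw [Real.exp_add, Real.exp_log (by linarith), ← pow_mul, ← Real.exp_nat_mul]
          congr 2
          push_cast
          ring
      _ ≤ d * ((1 - 1 / (d : ℝ)) ^ N) ^ 2 := by gcongr
  have h3 : 8 / (d * ((1 - 1 / (d : ℝ)) ^ N) ^ 2) ≤ (1 - ρ) / 3 := by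
    refine le_trans ?_ hd
    rw [Real.exp_neg, ← div_eq_mul_inv]
    gcongr
  linarith [le_tvDist hd2 α n N]

section MixingTime

variable {G : Type*} [AddCommGroup G] [Fintype G]

theorem mixingTime_le {μ : PMF G} {α : unitInterval} {ε : ℝ} {n : ℕ} (hn : 1 ≤ n)
    (h : ∀ m, n ≤ m → tvDist (walkLaw μ α m) (PMF.uniformOfFintype G) ≤ ε) :
    mixingTime μ α ε ≤ n :=
  Nat.sInf_le ⟨hn, h⟩

/-- The existence of `k` excludes the junk value `0` of the infimum of the empty set. -/
theorem lt_mixingTime {μ : PMF G} {α : unitInterval} {ε : ℝ} {n k : ℕ} (hk : 1 ≤ k)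
    (h : ∀ m, k ≤ m → tvDist (walkLaw μ α m) (PMF.uniformOfFintype G) ≤ ε)
    (hn : ε < tvDist (walkLaw μ α n) (PMF.uniformOfFintype G)) :
    n < mixingTime μ α ε := by
  by_contra hlt
  push Not at hlt
  have hmem := Nat.sInf_mem (s := {n : ℕ | 1 ≤ n ∧
    ∀ m, n ≤ m → tvDist (walkLaw μ α m) (PMF.uniformOfFintype G) ≤ ε}) ⟨k, hk, h⟩
  exact absurd (hmem.2 n hlt) (not_le.2 hn)

end MixingTime

theorem tendsto_mixingTime {α : unitInterval} (hα : (α : ℝ) < 1) {ε : ℝ} (hε0 : 0 < ε)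
    (hε1 : ε < 1) :
    Tendsto (fun d : ℕ => (mixingTime (lazyStep d) α ε : ℝ) / ((d : ℝ) * Real.log d)) atTop
      (𝓝 (1 / (2 * oddRate α))) := by
  have hr := oddRate_pos hα
  have hupper : ∀ a : ℝ, 0 < a → 1 / 2 < a * oddRate α → ∀ᶠ d : ℕ in atTop,
      1 ≤ ⌈a * ((d : ℝ) * Real.log d)⌉₊ ∧ ∀ m, ⌈a * ((d : ℝ) * Real.log d)⌉₊ ≤ m →
        tvDist (walkLaw (lazyStep d) α m) (PMF.uniformOfFintype (Fin d → ZMod 2)) ≤ ε := by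
    intro a ha har
    filter_upwards [eventually_tvDist_le ha har hε0,
      tendsto_natCast_mul_log.eventually_gt_atTop 0] with d hd hpos
    exact ⟨Nat.ceil_pos.2 (by positivity), fun m hm => hd m (Nat.ceil_le.1 hm)⟩
  refine tendsto_order.2 ⟨fun b hb => ?_, fun b hb => ?_⟩
  · -- a positive constant between `b` and the limit
    obtain ⟨a, hba, har⟩ := exists_between
      (max_lt hb (show (0 : ℝ) < 1 / (2 * oddRate α) by positivity))
    have ha : 0 < a := (le_max_right _ _).trans_lt hba
    rw [lt_div_iff₀ (by positivity)] at har
    filter_upwards [hupper (1 / oddRate α) (by positivity) (by field_simp; norm_num),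
      eventually_lt_tvDist ha hr (by linarith) hε1,
      tendsto_natCast_mul_log.eventually_gt_atTop 0] with d hd hlt hpos
    have h := lt_mixingTime hd.1 hd.2 hlt
    rw [lt_div_iff₀ hpos]
    calc b * (d * Real.log d) ≤ a * (d * Real.log d) := by
          have := (le_max_left b 0).trans hba.le
          gcongr
      _ < ⌊a * (d * Real.log d)⌋₊ + 1 := Nat.lt_floor_add_one _
      _ ≤ mixingTime (lazyStep d) α ε := by exact_mod_cast h
  · obtain ⟨a, har, hab⟩ := exists_between hb
    have ha : 0 < a := lt_trans (by positivity) har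
    rw [div_lt_iff₀ (by positivity)] at har
    filter_upwards [hupper a ha (by linarith), tendsto_natCast_mul_log.eventually_gt_atTop 0,
      (tendsto_natCast_mul_log.const_mul_atTop (sub_pos.2 hab)).eventually_ge_atTop 1]
      with d hd hpos hlarge
    rw [div_lt_iff₀ hpos]
    calc (mixingTime (lazyStep d) α ε : ℝ) ≤ ⌈a * ((d : ℝ) * Real.log d)⌉₊ := by
          exact_mod_cast mixingTime_le hd.1 hd.2
      _ < a * (d * Real.log d) + 1 := Nat.ceil_lt_add_one (by positivity)
      _ ≤ b * (d * Real.log d) := by linarith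

end SRRW
end

theorem theorem1p8 (α : unitInterval) (hα0 : (0 : ℝ) < (α : ℝ)) (hα1 : (α : ℝ) < 1)
    (ε : ℝ) (hε0 : 0 < ε) (hε1 : ε < 1) :
    Tendsto (fun d : ℕ => (SRRW.mixingTime (SRRW.lazyStep d) α ε : ℝ) / ((d : ℝ) * Real.log d))
      atTop
      (𝓝 (1 / ((1 - (α : ℝ)) *
        ordinaryHypergeometric (1 : ℝ) (α : ℝ)⁻¹ ((α : ℝ)⁻¹ + 1) (1 / 2 : ℝ)))) ∧
    Tendsto (fun d : ℕ => (SRRW.mixingTime (SRRW.lazyStep d) α ε : ℝ) /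
        (SRRW.mixingTime (SRRW.lazyStep d) α (1 - ε) : ℝ)) atTop (𝓝 1) ∧
    ∀ᶠ d : ℕ in atTop,
      SRRW.mixingTime (SRRW.lazyStep d) 0 ε < SRRW.mixingTime (SRRW.lazyStep d) α ε := by
  have hr := SRRW.oddRate_pos hα1
  have hlim := SRRW.tendsto_mixingTime hα1 hε0 hε1
  have hpos := SRRW.tendsto_natCast_mul_log.eventually_gt_atTop 0
  refine ⟨?_, ?_, ?_⟩
  · rwa [← SRRW.two_mul_oddRate hα0]
  · have hlim' := SRRW.tendsto_mixingTime hα1 (sub_pos.2 hε1) (sub_lt_self 1 hε0)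
    have hne : 1 / (2 * SRRW.oddRate α) ≠ 0 := by positivity
    have h := hlim.div hlim' hne
    rw [div_self hne] at h
    refine h.congr' ?_
    filter_upwards [hpos] with d hd
    exact div_div_div_cancel_right₀ hd.ne' _ _
  · have hlim0 := SRRW.tendsto_mixingTime (α := 0) (by norm_num) hε0 hε1
    have hlt : 1 / (2 * SRRW.oddRate 0) < 1 / (2 * SRRW.oddRate α) := by
      rw [SRRW.oddRate_zero]
      have := SRRW.oddRate_le α
      exact one_div_lt_one_div_of_lt (by positivity) (by linarith)
    filter_upwards [hlim0.eventually_lt hlim hlt, hpos] with d hd hd0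
    rw [div_lt_div_iff_of_pos_right hd0] at hd
    exact_mod_cast hd
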